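/- Let $\alpha_1<\alpha_2<\alpha_3$ be real numbers, let $\rho_1,\rho_2,\rho_3>0$, let $k\ge 1$ be an integer, and put $A(x)=\prod_{i=1}^3(x-\alpha_i)$. Call a real number $\nu$ a Van Vleck zero of order $k$ if for some constant $\mu\in\mathbb{R}$ the generalized Lamé equation $$S''(x)+\sum_{i=1}^3\frac{\rho_i}{x-\alpha_i}\,S'(x)=\frac{\mu\,(x-\nu)}{A(x)}\,S(x)\qquad(x\ne\alpha_1,\alpha_2,\alpha_3)$$ has a real polynomial solution $S$ of degree exactly $k$; every such $S$ is called a Stieltjes polynomial of degree $k$ belonging to $\nu$. Then there are exactly $k+1$ Van Vleck zeros of order $k$, say $\nu_1^{(k)}<\nu_2^{(k)}<\cdots<\nu_{k+1}^{(k)}$. Moreover, for $1\le j\le k$, let $S_j^{(k)}$ and $S_{j+1}^{(k)}$ be any Stieltjes polynomials of degree $k$ belonging to $\nu_j^{(k)}$ and $\nu_{j+1}^{(k)}$ respectively. Then each of them has exactly $k$ distinct real zeros, $x_{1,j}^{(k)}<\cdots<x_{k,j}^{(k)}$ and $x_{1,j+1}^{(k)}<\cdots<x_{k,j+1}^{(k)}$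 respectively, and these zeros interlace: $$\alpha_1 < x_{1,j+1}^{(k)} < x_{1,j}^{(k)} < x_{2,j+1}^{(k)} < x_{2,j}^{(k)} < \cdots < x_{k,j+1}^{(k)} < x_{k,j}^{(k)} < \alpha_3.$$ In particular, between any two consecutive zeros of $S_j^{(k)}$ there is exactly one zero of $S_{j+1}^{(k)}$, and the smallest zero of $S_{j+1}^{(k)}$ is less than the smallest zero of $S_j^{(k)}$. -/

import Mathlib

open Polynomial

/-- `S` solves the generalized Lamé equation
`S'' + ∑ i, ρ i / (x - α i) * S' = V / A * S`, where `A = ∏ i, (x - α i)`,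
at every real point at which its coefficients are defined. -/
def IsLameSolution (α ρ : Fin 3 → ℝ) (V S : ℝ[X]) : Prop :=
  ∀ x : ℝ, (∀ i, x ≠ α i) →
    S.derivative.derivative.eval x + (∑ i, ρ i / (x - α i)) * S.derivative.eval x =
      V.eval x / (∏ i, (x - α i)) * S.eval x

/-- `S` is a Stieltjes polynomial of degree `k` whose Van Vleck polynomial is
`V = μ (x - ν)` for some constant `μ`. -/
def IsStieltjesPoly (α ρ : Fin 3 → ℝ) (k : ℕ) (ν : ℝ) (S : ℝ[X]) : Prop :=
  S.degree = (k : WithBot ℕ) ∧ ∃ μ : ℝ, IsLameSolution α ρ (C μ * (X - C ν)) S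

/-- The Van Vleck zeros of order `k`. -/
def vanVleckZeros (α ρ : Fin 3 → ℝ) (k : ℕ) : Set ℝ :=
  {ν | ∃ S : ℝ[X], IsStieltjesPoly α ρ k ν S}

/-! Existence is linear algebra. In powers of `x - α 1` the equation with denominators cleared is a
three-term recurrence, and the top coefficient forces `μ = k (k - 1) + k ∑ ρ i > 0`. Hence `ν` is a
Van Vleck zero iff `μ (ν - α 1)` is an eigenvalue of a tridiagonal matrix of size `k + 1`. Expanding
at the middle singular point makes both off-diagonals positive, so the matrix is similar to a
symmetric Jacobi matrix, whose eigenvalues are real and simple (`exists_jacobiEigen`).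

Interlacing is Sturm comparison (`IsLameSolution.exists_isRoot_of_lt`). The weight vanishes at each
`α i`, so singular points serve as zeros. Raising `ν` lowers `μ (x - ν) / A` on `(α 0, α 1)`, where
`A > 0`, and raises it on `(α 1, α 2)`, where `A < 0`. Each step up in `ν` therefore adds at least
one zero on the left, and each step down adds one on the right. Counting from index `0`, the `j`-th
polynomial has at least `j` zeros on the left and `k - j` on the right; its degree is `k`, so these
counts are exact (`card_rootsIoo_eq`). The two local interlacings are then joined across `α 1`. -/

/-- The integrating factor of the Lamé equation. -/
noncomputable def lameWeight (α ρ : Fin 3 → ℝ) (x : ℝ) : ℝ := ∏ i, |x - α i| ^ ρ i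

theorem lameWeight_nonneg (α ρ : Fin 3 → ℝ) (x : ℝ) : 0 ≤ lameWeight α ρ x :=
  Finset.prod_nonneg fun _ _ => Real.rpow_nonneg (abs_nonneg _) _

theorem lameWeight_pos (α ρ : Fin 3 → ℝ) {x : ℝ} (hx : ∀ i, x ≠ α i) : 0 < lameWeight α ρ x :=
  Finset.prod_pos fun i _ => Real.rpow_pos_of_pos (abs_pos.2 (sub_ne_zero.2 (hx i))) _

theorem lameWeight_apply_self {α ρ : Fin 3 → ℝ} (hρ : ∀ i, 0 < ρ i) (i : Fin 3) :
    lameWeight α ρ (α i) = 0 :=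
  Finset.prod_eq_zero (Finset.mem_univ i) (by simp [Real.zero_rpow (hρ i).ne'])

theorem continuous_lameWeight {α ρ : Fin 3 → ℝ} (hρ : ∀ i, 0 < ρ i) :
    Continuous (lameWeight α ρ) := by
  unfold lameWeight
  refine continuous_finsetProd _ fun i _ => ?_
  exact (by fun_prop : Continuous fun x : ℝ => |x - α i|).rpow_const fun _ => Or.inr (hρ i).le

theorem hasDerivAt_lameWeight (α ρ : Fin 3 → ℝ) {x : ℝ} (hx : ∀ i, x ≠ α i) :
    HasDerivAt (lameWeight α ρ) (lameWeight α ρ x * ∑ i, ρ i / (x - α i)) x := by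
  -- `Real.log` is even, so one formula serves on both sides of every `α i`.
  have key : ∀ t : ℝ, (∀ i, t ≠ α i) →
      lameWeight α ρ t = Real.exp (∑ i, ρ i * Real.log (t - α i)) := by
    intro t ht
    rw [lameWeight, Real.exp_sum]
    refine Finset.prod_congr rfl fun i _ => ?_
    rw [Real.rpow_def_of_pos (abs_pos.2 (sub_ne_zero.2 (ht i))), Real.log_abs, mul_comm]
  have hev : lameWeight α ρ =ᶠ[nhds x] fun t => Real.exp (∑ i, ρ i * Real.log (t - α i)) := by
    filter_upwards [Filter.eventually_all.2 fun i => isOpen_ne.mem_nhds (hx i)] with t ht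
    exact key t ht
  rw [key x hx]
  refine HasDerivAt.congr_of_eventuallyEq ?_ hev
  refine HasDerivAt.exp ?_
  refine HasDerivAt.fun_sum fun i _ => ?_
  have h := (((hasDerivAt_id x).sub_const (α i)).log (sub_ne_zero.2 (hx i))).const_mul (ρ i)
  simpa [div_eq_mul_inv] using h

/-! ### Sturm comparison between singular points -/

theorem IsLameSolution.neg {α ρ : Fin 3 → ℝ} {V S : ℝ[X]} (h : IsLameSolution α ρ V S) :
    IsLameSolution α ρ V (-S) := by
  intro x hx
  have := h x hx
  simp only [derivative_neg, eval_neg]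
  linear_combination -this

theorem Polynomial.eval_nonneg_of_Ioo {p : ℝ[X]} {c d : ℝ} (hcd : c < d)
    (h : ∀ x ∈ Set.Ioo c d, 0 ≤ p.eval x) : ∀ x ∈ Set.Icc c d, 0 ≤ p.eval x := by
  intro x hx
  rw [← closure_Ioo hcd.ne] at hx
  exact le_on_closure h continuousOn_const p.continuous.continuousOn hx

/-- Writing `p = (X - c) q` gives `p'(c) = q(c)`, and `q` is positive on the interval, hence
nonnegative at its end. -/
theorem Polynomial.derivative_eval_nonneg_left {p : ℝ[X]} {c d : ℝ} (hcd : c < d)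
    (h : ∀ x ∈ Set.Ioo c d, 0 < p.eval x) (hc : p.IsRoot c) : 0 ≤ p.derivative.eval c := by
  obtain ⟨q, rfl⟩ := dvd_iff_isRoot.2 hc
  have hq := Polynomial.eval_nonneg_of_Ioo (p := q) hcd (fun x hx => by
    have := h x hx
    rw [eval_mul] at this
    exact (pos_of_mul_pos_right this (by simpa using hx.1.le)).le) c ⟨le_rfl, hcd.le⟩
  simpa using hq

theorem Polynomial.derivative_eval_nonpos_right {p : ℝ[X]} {c d : ℝ} (hcd : c < d)
    (h : ∀ x ∈ Set.Ioo c d, 0 < p.eval x) (hd : p.IsRoot d) : p.derivative.eval d ≤ 0 := by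
  obtain ⟨q, rfl⟩ := dvd_iff_isRoot.2 hd
  have hq := Polynomial.eval_nonneg_of_Ioo (p := -q) hcd (fun x hx => by
    have := h x hx
    rw [eval_mul] at this
    rw [eval_neg]
    simp only [eval_sub, eval_X, eval_C] at this
    nlinarith [hx.2, pos_of_mul_pos_right (a := d - x) (b := -q.eval x) (by linarith) (by linarith [hx.2])])
    d ⟨hcd.le, le_rfl⟩
  simpa using hq

theorem Polynomial.pos_or_neg_of_Ioo {p : ℝ[X]} {c d : ℝ}
    (h : ∀ x ∈ Set.Ioo c d, p.eval x ≠ 0) :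
    (∀ x ∈ Set.Ioo c d, 0 < p.eval x) ∨ (∀ x ∈ Set.Ioo c d, 0 < (-p).eval x) := by
  by_contra! hcon
  obtain ⟨⟨x, hx, hx0⟩, y, hy, hy0⟩ := hcon
  rw [eval_neg] at hy0
  obtain ⟨z, hz, hz0⟩ := isPreconnected_Ioo.intermediate_value hx hy p.continuous.continuousOn
    (show (0 : ℝ) ∈ Set.Icc _ _ from ⟨hx0, by linarith⟩)
  exact h z hz hz0

/-- The core of the Sturm comparison: the weighted Wronskian of two positive solutions would be
strictly decreasing, against its signs at the endpoints. -/
theorem IsLameSolution.not_both_pos {α ρ : Fin 3 → ℝ} (hρ : ∀ i, 0 < ρ i) {V W S T : ℝ[X]}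
    (hS : IsLameSolution α ρ V S) (hT : IsLameSolution α ρ W T) {c d : ℝ} (hcd : c < d)
    (hα : ∀ x ∈ Set.Ioo c d, ∀ i, x ≠ α i)
    (hVW : ∀ x ∈ Set.Ioo c d, W.eval x / (∏ i, (x - α i)) < V.eval x / (∏ i, (x - α i)))
    (hc : (∃ i, c = α i) ∨ S.IsRoot c) (hd : (∃ i, d = α i) ∨ S.IsRoot d)
    (hS0 : ∀ x ∈ Set.Ioo c d, 0 < S.eval x) (hT0 : ∀ x ∈ Set.Ioo c d, 0 < T.eval x) : False := by
  set F : ℝ → ℝ := fun x => lameWeight α ρ x *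
    (S.eval x * T.derivative.eval x - S.derivative.eval x * T.eval x) with hF
  have hcont : Continuous F := (continuous_lameWeight hρ).mul (by fun_prop)
  have hderiv : ∀ x ∈ Set.Ioo c d, deriv F x < 0 := by
    intro x hx
    have h1 := (hasDerivAt_lameWeight α ρ (hα x hx)).mul
      (((S.hasDerivAt x).mul (T.derivative.hasDerivAt x)).sub
        ((S.derivative.hasDerivAt x).mul (T.hasDerivAt x)))
    have h2 : deriv F x = lameWeight α ρ x * (S.eval x * T.eval x *
        (W.eval x / (∏ i, (x - α i)) - V.eval x / (∏ i, (x - α i)))) := by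
      refine h1.deriv.trans ?_
      simp only [Pi.mul_apply, Pi.sub_apply]
      linear_combination (lameWeight α ρ x * S.eval x) * hT x (hα x hx) -
        (lameWeight α ρ x * T.eval x) * hS x (hα x hx)
    rw [h2]
    exact mul_neg_of_pos_of_neg (lameWeight_pos α ρ (hα x hx))
      (mul_neg_of_pos_of_neg (mul_pos (hS0 x hx) (hT0 x hx)) (sub_neg.2 (hVW x hx)))
  have hanti : StrictAntiOn F (Set.Icc c d) :=
    strictAntiOn_of_deriv_neg (convex_Icc c d) hcont.continuousOn (by simpa using hderiv)
  have hlt := hanti ⟨le_rfl, hcd.le⟩ ⟨hcd.le, le_rfl⟩ hcd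
  have hTn := Polynomial.eval_nonneg_of_Ioo hcd fun x hx => (hT0 x hx).le
  -- At a singular endpoint the weight vanishes; at a zero of `S` only the term `-w S' T` survives,
  -- and the sign of `S'` is known there.
  have hFc : F c ≤ 0 := by
    rcases hc with ⟨i, rfl⟩ | hc
    · simp [hF, lameWeight_apply_self hρ]
    · have h1 := Polynomial.derivative_eval_nonneg_left hcd hS0 hc
      have h2 := mul_nonneg (lameWeight_nonneg α ρ c)
        (mul_nonneg h1 (hTn c ⟨le_rfl, hcd.le⟩))
      have h3 : S.eval c = 0 := hc
      simp only [hF, h3]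
      linarith
  have hFd : 0 ≤ F d := by
    rcases hd with ⟨i, rfl⟩ | hd
    · simp [hF, lameWeight_apply_self hρ]
    · have h1 := Polynomial.derivative_eval_nonpos_right hcd hS0 hd
      have h2 := mul_nonneg (lameWeight_nonneg α ρ d)
        (mul_nonneg (neg_nonneg.2 h1) (hTn d ⟨hcd.le, le_rfl⟩))
      have h3 : S.eval d = 0 := hd
      simp only [hF, h3]
      linarith
  linarith

/-- Sturm comparison, where a singular point may stand in for a zero of `S`. -/
theorem IsLameSolution.exists_isRoot_of_lt {α ρ : Fin 3 → ℝ} (hρ : ∀ i, 0 < ρ i)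
    {V W S T : ℝ[X]}
    (hS : IsLameSolution α ρ V S) (hT : IsLameSolution α ρ W T) {c d : ℝ} (hcd : c < d)
    (hα : ∀ x ∈ Set.Ioo c d, ∀ i, x ≠ α i)
    (hVW : ∀ x ∈ Set.Ioo c d, W.eval x / (∏ i, (x - α i)) < V.eval x / (∏ i, (x - α i)))
    (hc : (∃ i, c = α i) ∨ S.IsRoot c) (hd : (∃ i, d = α i) ∨ S.IsRoot d)
    (hS0 : ∀ x ∈ Set.Ioo c d, ¬ S.IsRoot x) : ∃ t ∈ Set.Ioo c d, T.IsRoot t := by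
  by_contra! hT0
  have hc' : (∃ i, c = α i) ∨ (-S).IsRoot c := by simpa [IsRoot.def] using hc
  have hd' : (∃ i, d = α i) ∨ (-S).IsRoot d := by simpa [IsRoot.def] using hd
  rcases Polynomial.pos_or_neg_of_Ioo hS0 with h1 | h1 <;>
    rcases Polynomial.pos_or_neg_of_Ioo hT0 with h2 | h2
  · exact hS.not_both_pos hρ hT hcd hα hVW hc hd h1 h2
  · exact hS.not_both_pos hρ hT.neg hcd hα hVW hc hd h1 h2
  · exact hS.neg.not_both_pos hρ hT hcd hα hVW hc' hd' h1 h2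
  · exact hS.neg.not_both_pos hρ hT.neg hcd hα hVW hc' hd' h1 h2

/-! ### Gaps between zeros -/

/-- A finite subset of an interval cuts it into consecutive gaps. -/
theorem Finset.exists_gaps (X : Finset ℝ) : ∀ {a b : ℝ}, a < b → (∀ x ∈ X, a < x ∧ x < b) →
    ∃ e : ℕ → ℝ, e 0 = a ∧ e (X.card + 1) = b ∧ (∀ i ≤ X.card, e i < e (i + 1)) ∧
      (∀ i < X.card, e (i + 1) ∈ X) ∧
      ∀ i ≤ X.card, ∀ x ∈ X, ¬ (e i < x ∧ x < e (i + 1)) := by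
  induction X using Finset.induction_on_max with
  | empty =>
    intro a b hab _
    refine ⟨fun i => if i = 0 then a else b, by simp, by simp, ?_, by simp, by simp⟩
    intro i hi
    obtain rfl : i = 0 := by simpa using hi
    simpa using hab
  | insert M X hM ih =>
    intro a b hab hX
    have hMX : M ∉ X := fun h => lt_irrefl _ (hM M h)
    obtain ⟨haM, hMb⟩ := hX M (Finset.mem_insert_self _ _)
    -- The induction hypothesis is used with right end `M`; the one new gap is `(M, b)`.
    obtain ⟨e, h0, h1, hlt, hmem, hgap⟩ := ih haM fun x hx =>
      ⟨(hX x (Finset.mem_insert_of_mem hx)).1, hM x hx⟩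
    rw [Finset.card_insert_of_notMem hMX]
    set m := X.card
    have he : ∀ i ≤ m + 1, (fun i => if i ≤ m + 1 then e i else b) i = e i := fun i hi => by
      simp [hi]
    have hb : (fun i => if i ≤ m + 1 then e i else b) (m + 1 + 1) = b := by simp
    refine ⟨fun i => if i ≤ m + 1 then e i else b, ?_, hb, ?_, ?_, ?_⟩
    · rw [he 0 (by omega), h0]
    · intro i hi
      rcases Nat.lt_or_ge m i with h | h
      · obtain rfl : i = m + 1 := by omega
        rw [he _ le_rfl, hb, h1]
        exact hMb
      · rw [he _ (by omega), he _ (by omega)]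
        exact hlt i h
    · intro i hi
      rw [he _ (by omega)]
      rcases Nat.lt_or_ge i m with h | h
      · exact Finset.mem_insert_of_mem (hmem i h)
      · obtain rfl : i = m := by omega
        rw [h1]
        exact Finset.mem_insert_self _ _
    · intro i hi x hx
      rcases Nat.lt_or_ge m i with h | h
      · obtain rfl : i = m + 1 := by omega
        rw [he _ le_rfl, h1]
        rintro ⟨h2, -⟩
        rcases Finset.mem_insert.1 hx with rfl | hx
        · exact lt_irrefl _ h2
        · exact lt_asymm h2 (hM x hx)
      · rw [he _ (by omega), he _ (by omega)]
        rcases Finset.mem_insert.1 hx with rfl | hx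
        · rintro ⟨-, h2⟩
          rw [← h1] at h2
          have hmono : ∀ l, i + 1 + l ≤ m + 1 → e (i + 1) ≤ e (i + 1 + l) := by
            intro l
            induction l with
            | zero => simp
            | succ l ihl =>
              intro hl
              exact (ihl (by omega)).trans (hlt (i + 1 + l) (by omega)).le
          have := hmono (m - i) (by omega)
          rw [show i + 1 + (m - i) = m + 1 by omega] at this
          linarith
        · exact hgap i h x hx

/-- The zeros of `S` in the open interval `(a, b)`. -/
noncomputable def rootsIoo (S : ℝ[X]) (a b : ℝ) : Finset ℝ :=
  S.roots.toFinset.filter fun x => a < x ∧ x < b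

theorem mem_rootsIoo {S : ℝ[X]} (hS : S ≠ 0) {a b x : ℝ} :
    x ∈ rootsIoo S a b ↔ S.IsRoot x ∧ a < x ∧ x < b := by
  simp [rootsIoo, hS]

/-- If `T` has a zero in every gap of `S`, then the zeros of `T` surround those of `S`. -/
theorem exists_interlacing {S T : ℝ[X]} (hS : S ≠ 0) {a b : ℝ} (hab : a < b)
    (h : ∀ c d, a ≤ c → c < d → d ≤ b → (c = a ∨ S.IsRoot c) → (d = b ∨ S.IsRoot d) →
      (∀ x ∈ Set.Ioo c d, ¬ S.IsRoot x) → ∃ t ∈ Set.Ioo c d, T.IsRoot t) :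
    ∃ e z : ℕ → ℝ,
      (∀ i < (rootsIoo S a b).card, S.IsRoot (e i) ∧ a < e i ∧ e i < b) ∧
      (∀ i ≤ (rootsIoo S a b).card, T.IsRoot (z i) ∧ a < z i ∧ z i < b) ∧
      ∀ i < (rootsIoo S a b).card, z i < e i ∧ e i < z (i + 1) := by
  obtain ⟨e, h0, h1, hlt, hmem, hgap⟩ := (rootsIoo S a b).exists_gaps hab
    fun x hx => ((mem_rootsIoo hS).1 hx).2
  set m := (rootsIoo S a b).card
  have hmem' : ∀ i < m, S.IsRoot (e (i + 1)) ∧ a < e (i + 1) ∧ e (i + 1) < b := fun i hi =>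
    (mem_rootsIoo hS).1 (hmem i hi)
  have hz : ∀ i, ∃ t, i ≤ m → T.IsRoot t ∧ e i < t ∧ t < e (i + 1) ∧ a < t ∧ t < b := by
    intro i
    by_cases hi : i ≤ m
    swap
    -- Dummy value, so that `choose` yields a sequence on all of `ℕ`.
    · exact ⟨0, fun h => absurd h hi⟩
    have hc : a ≤ e i ∧ (e i = a ∨ S.IsRoot (e i)) := by
      cases i with
      | zero => exact ⟨h0.ge, Or.inl h0⟩
      | succ i => exact ⟨(hmem' i hi).2.1.le, Or.inr (hmem' i hi).1⟩
    have hd : e (i + 1) ≤ b ∧ (e (i + 1) = b ∨ S.IsRoot (e (i + 1))) := by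
      rcases hi.eq_or_lt with rfl | hi
      · exact ⟨h1.le, Or.inl h1⟩
      · exact ⟨(hmem' i hi).2.2.le, Or.inr (hmem' i hi).1⟩
    obtain ⟨t, ht, htT⟩ := h _ _ hc.1 (hlt i hi) hd.1 hc.2 hd.2 fun x hx hxS =>
      hgap i hi x ((mem_rootsIoo hS).2 ⟨hxS, hc.1.trans_lt hx.1, hx.2.trans_le hd.1⟩) hx
    exact ⟨t, fun _ => ⟨htT, ht.1, ht.2, hc.1.trans_lt ht.1, ht.2.trans_le hd.1⟩⟩
  choose z hz using hz
  exact ⟨fun i => e (i + 1), z, hmem', fun i hi => ⟨(hz i hi).1, (hz i hi).2.2.2⟩,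
    fun i hi => ⟨(hz i hi.le).2.2.1, (hz (i + 1) hi).2.1⟩⟩

/-! ### Simple real spectrum of tridiagonal matrices -/

/-- `c` solves, on the indices `0, …, k`, the eigenvalue equation of the tridiagonal matrix with
lower diagonal `U`, diagonal `G`, upper diagonal `L`. -/
def JacobiEigen (U G L : ℕ → ℝ) (k : ℕ) (l : ℝ) (c : ℕ → ℝ) : Prop :=
  (∀ n, k < n → c n = 0) ∧ G 0 * c 0 + L 0 * c 1 = l * c 0 ∧
    ∀ n < k, U n * c n + G (n + 1) * c (n + 1) + L (n + 1) * c (n + 2) = l * c (n + 1)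

/-- As `L n ≠ 0`, each row determines the next entry from the previous ones. An eigenvector is thus
fixed by its first entry, which makes eigenvalues simple. -/
theorem JacobiEigen.eq_zero {U G L : ℕ → ℝ} {k : ℕ} {l : ℝ} {c : ℕ → ℝ}
    (h : JacobiEigen U G L k l c) (hL : ∀ n < k, L n ≠ 0) (h0 : c 0 = 0) : c = 0 := by
  obtain ⟨h1, h2, h3⟩ := h
  have hind : ∀ n, c n = 0 ∧ c (n + 1) = 0 := by
    intro n
    induction n with
    | zero =>
      refine ⟨h0, ?_⟩
      rcases Nat.eq_zero_or_pos k with rfl | hk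
      · exact h1 1 one_pos
      · rw [h0] at h2
        simpa [hL 0 hk] using h2
    | succ n ih =>
      refine ⟨ih.2, ?_⟩
      rcases Nat.lt_or_ge (n + 1) k with hn | hn
      · have := h3 n (by omega)
        rw [ih.1, ih.2] at this
        simpa [hL (n + 1) hn] using this
      · exact h1 _ (by omega)
  exact funext fun n => (hind n).1

/-- The symmetric tridiagonal matrix with diagonal `G` and off-diagonal `s`. -/
def jacobiMatrix (G s : ℕ → ℝ) (k : ℕ) : Matrix (Fin (k + 1)) (Fin (k + 1)) ℝ :=
  fun i j => (if (j : ℕ) = i then G i else 0) + (if (j : ℕ) = i + 1 then s i else 0) +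
    (if (i : ℕ) = j + 1 then s j else 0)

theorem jacobiMatrix_isHermitian (G s : ℕ → ℝ) (k : ℕ) : (jacobiMatrix G s k).IsHermitian := by
  ext i j
  simp only [Matrix.conjTranspose_apply, jacobiMatrix, star_trivial]
  by_cases h : (i : ℕ) = j
  · simp [h]
  · simp only [h, Ne.symm h, if_false]
    ring

/-- Extension of a vector by zero to a sequence. -/
def extendZero {k : ℕ} (v : Fin (k + 1) → ℝ) (n : ℕ) : ℝ := if h : n < k + 1 then v ⟨n, h⟩ else 0

theorem extendZero_val {k : ℕ} (v : Fin (k + 1) → ℝ) (i : Fin (k + 1)) :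
    extendZero v i = v i := by
  simp [extendZero, i.isLt, -Order.lt_add_one_iff]

theorem jacobiMatrix_mulVec (G s : ℕ → ℝ) (k : ℕ) {c : ℕ → ℝ} (hc : ∀ n, k < n → c n = 0)
    (i : Fin (k + 1)) :
    (jacobiMatrix G s k).mulVec (fun j => c j) i = G i * c i + s i * c (i + 1) +
      (if (i : ℕ) = 0 then 0 else s (i - 1) * c (i - 1)) := by
  simp only [Matrix.mulVec, dotProduct, jacobiMatrix]
  rw [Fin.sum_univ_eq_sum_range (fun j => ((if j = (i : ℕ) then G i else 0) +
    (if j = (i : ℕ) + 1 then s i else 0) + (if (i : ℕ) = j + 1 then s j else 0)) * c j) (k + 1)]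
  simp only [add_mul, ite_mul, zero_mul, Finset.sum_add_distrib, Finset.sum_ite_eq',
    Finset.mem_range, i.isLt, if_true]
  congr 1
  · congr 1
    split_ifs with h
    · rfl
    · rw [hc _ (by omega), mul_zero]
  · split_ifs with h
    · simp [h]
    · obtain ⟨m, hm⟩ := Nat.exists_eq_succ_of_ne_zero h
      have hi := i.isLt
      simp only [hm, Nat.succ_eq_add_one, add_left_inj, add_tsub_cancel_right]
      rw [Finset.sum_ite_eq, if_pos (Finset.mem_range.2 (by omega))]

theorem jacobiMatrix_mulVec_eq_smul_iff (G s : ℕ → ℝ) (k : ℕ) (l : ℝ) {c : ℕ → ℝ}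
    (hc : ∀ n, k < n → c n = 0) :
    (jacobiMatrix G s k).mulVec (fun j => c j) = l • (fun j : Fin (k + 1) => c j) ↔
      JacobiEigen s G s k l c := by
  rw [funext_iff]
  simp only [jacobiMatrix_mulVec G s k hc, Pi.smul_apply, smul_eq_mul]
  constructor
  · intro h
    refine ⟨hc, by simpa using h 0, fun n hn => ?_⟩
    have := h ⟨n + 1, by omega⟩
    simp at this
    linarith
  · rintro ⟨-, h0, h1⟩ ⟨n, hn⟩
    cases n with
    | zero => simpa using h0
    | succ n =>
      have := h1 n (by omega)
      simp
      linarith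

theorem exists_jacobiEigen_symm (G s : ℕ → ℝ) (k : ℕ) (hs : ∀ n < k, s n ≠ 0) :
    ∃ l : Fin (k + 1) → ℝ, StrictMono l ∧
      ∀ t, t ∈ Set.range l ↔ ∃ c, c ≠ 0 ∧ JacobiEigen s G s k t c := by
  have hH := jacobiMatrix_isHermitian G s k
  have hz : ∀ v : Fin (k + 1) → ℝ, ∀ n, k < n → extendZero v n = 0 := fun v n hn => by
    simp [extendZero, show ¬ n < k + 1 by omega]
  have hv : ∀ (v : Fin (k + 1) → ℝ) (t : ℝ), (jacobiMatrix G s k).mulVec v = t • v →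
      JacobiEigen s G s k t (extendZero v) := fun v t h => by
    rw [← jacobiMatrix_mulVec_eq_smul_iff G s k t (hz v)]
    simpa only [extendZero_val] using h
  have hv0 : ∀ (v : Fin (k + 1) → ℝ) (t : ℝ), (jacobiMatrix G s k).mulVec v = t • v →
      v 0 = 0 → v = 0 := fun v t h h0 => by
    have := (hv v t h).eq_zero hs (by simpa [extendZero] using h0)
    funext i
    rw [← extendZero_val v i, this]
    rfl
  have hinj : Function.Injective hH.eigenvalues := by
    intro i j hij
    by_contra hne
    have hi := hH.mulVec_eigenvectorBasis i
    have hj := hH.mulVec_eigenvectorBasis j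
    rw [← hij] at hj
    have hli := hH.eigenvectorBasis.orthonormal.linearIndependent
    set u := hH.eigenvectorBasis i
    set w := hH.eigenvectorBasis j
    have hu : u ≠ 0 := hli.ne_zero i
    have hu0 : u.ofLp 0 ≠ 0 := fun h => hu (by
      have := hv0 _ _ hi h
      ext n
      exact congrFun this n)
    -- This combination of two eigenvectors for one eigenvalue has first entry zero, so it vanishes;
    -- pairing it with `w` then gives `u 0 = 0`.
    have hzero := hv0 (w.ofLp 0 • u.ofLp - u.ofLp 0 • w.ofLp) (hH.eigenvalues i) (by
      rw [Matrix.mulVec_sub, Matrix.mulVec_smul, Matrix.mulVec_smul, hi, hj]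
      ext n
      simp
      ring) (by simp [mul_comm])
    have hcomb : w.ofLp 0 • u + (-u.ofLp 0) • w = 0 := by
      ext n
      have := congrFun hzero n
      simp at this ⊢
      linarith
    have huw : inner ℝ u w = 0 := hH.eigenvectorBasis.orthonormal.2 hne
    have hww : inner ℝ w w = (1 : ℝ) := by
      rw [real_inner_self_eq_norm_sq, hH.eigenvectorBasis.orthonormal.1 j, one_pow]
    have := congrArg (fun v => inner ℝ v w) hcomb
    simp only [inner_add_left, real_inner_smul_left, huw, hww, inner_zero_left] at this
    exact hu0 (by linarith)
  have hcard : (Finset.univ.image hH.eigenvalues).card = k + 1 := by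
    rw [Finset.card_image_of_injective _ hinj]
    simp
  refine ⟨(Finset.univ.image hH.eigenvalues).orderEmbOfFin hcard, OrderEmbedding.strictMono _,
    fun t => ?_⟩
  rw [Finset.range_orderEmbOfFin]
  simp only [Finset.coe_image, Finset.coe_univ, Set.image_univ]
  constructor
  · rintro ⟨i, rfl⟩
    refine ⟨extendZero (hH.eigenvectorBasis i).ofLp, fun h => ?_,
      hv _ _ (hH.mulVec_eigenvectorBasis i)⟩
    refine hH.eigenvectorBasis.orthonormal.linearIndependent.ne_zero i ?_
    ext n
    rw [← extendZero_val (hH.eigenvectorBasis i).ofLp n, h]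
    rfl
  · rintro ⟨c, hc0, hc⟩
    rw [← hH.spectrum_real_eq_range_eigenvalues, ← Matrix.spectrum_toLin',
      ← Module.End.hasEigenvalue_iff_mem_spectrum]
    have h1 := (jacobiMatrix_mulVec_eq_smul_iff G s k t hc.1).2 hc
    refine Module.End.hasEigenvalue_of_hasEigenvector (x := fun j : Fin (k + 1) => c j)
      ⟨Module.End.mem_eigenspace_iff.2 (by simpa using h1), fun h => hc0 ?_⟩
    exact hc.eq_zero hs (congrFun h 0)

/-- The diagonal scaling that symmetrizes a tridiagonal matrix. -/
noncomputable def jacobiScale (U L : ℕ → ℝ) : ℕ → ℝ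
  | 0 => 1
  | n + 1 => jacobiScale U L n * √(U n / L n)

theorem exists_jacobiEigen (U G L : ℕ → ℝ) (k : ℕ) (hU : ∀ n < k, 0 < U n)
    (hL : ∀ n < k, 0 < L n) :
    ∃ l : Fin (k + 1) → ℝ, StrictMono l ∧
      ∀ t, t ∈ Set.range l ↔ ∃ c, c ≠ 0 ∧ JacobiEigen U G L k t c := by
  obtain ⟨l, hl, hl'⟩ := exists_jacobiEigen_symm G (fun n => √(U n * L n)) k
    fun n hn => (Real.sqrt_pos.2 (mul_pos (hU n hn) (hL n hn))).ne'
  refine ⟨l, hl, fun t => (hl' t).trans ?_⟩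
  set d := jacobiScale U L
  have hd : ∀ n ≤ k, 0 < d n := by
    intro n
    induction n with
    | zero => exact fun _ => one_pos
    | succ n ih =>
      exact fun hn => mul_pos (ih (by omega)) (Real.sqrt_pos.2 (div_pos (hU n hn) (hL n hn)))
  have hup : ∀ n < k, U n * d n = d (n + 1) * √(U n * L n) := by
    intro n hn
    have h1 : √(U n / L n) * √(U n * L n) = U n := by
      rw [← Real.sqrt_mul (div_pos (hU n hn) (hL n hn)).le,
        show U n / L n * (U n * L n) = U n ^ 2 by field_simp [(hL n hn).ne'],
        Real.sqrt_sq (hU n hn).le]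
    change _ = d n * √(U n / L n) * _
    rw [mul_assoc, h1, mul_comm]
  have hdown : ∀ n < k, L n * d (n + 1) = d n * √(U n * L n) := by
    intro n hn
    have h1 : L n * √(U n / L n) = √(U n * L n) := by
      rw [show U n * L n = L n ^ 2 * (U n / L n) by field_simp [(hL n hn).ne'],
        Real.sqrt_mul (sq_nonneg _), Real.sqrt_sq (hL n hn).le]
    change _ * (d n * √(U n / L n)) = _
    rw [← h1]
    ring
  -- The support condition is stated separately because `d n` may vanish for `n > k`.
  have key : ∀ c : ℕ → ℝ, JacobiEigen U G L k t (fun n => d n * c n) ∧ (∀ n, k < n → c n = 0) ↔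
      JacobiEigen (fun n => √(U n * L n)) G (fun n => √(U n * L n)) k t c := by
    intro c
    by_cases hc : ∀ n, k < n → c n = 0
    swap
    · exact ⟨fun h => absurd h.2 hc, fun h => absurd h.1 hc⟩
    have hdown' : ∀ n ≤ k, L n * (d (n + 1) * c (n + 1)) = d n * (√(U n * L n) * c (n + 1)) := by
      intro n hn
      rcases hn.lt_or_eq with hn | rfl
      · linear_combination c (n + 1) * hdown n hn
      · simp [hc (n + 1) (by omega)]
    have h0 : G 0 * (d 0 * c 0) + L 0 * (d 1 * c 1) = t * (d 0 * c 0) ↔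
        G 0 * c 0 + √(U 0 * L 0) * c 1 = t * c 0 := by
      rw [← mul_right_inj' (hd 0 (by omega)).ne' (b := G 0 * c 0 + √(U 0 * L 0) * c 1)]
      have := hdown' 0 (by omega)
      constructor <;> intro h <;> linarith
    have h1 : ∀ n < k, (U n * (d n * c n) + G (n + 1) * (d (n + 1) * c (n + 1)) +
        L (n + 1) * (d (n + 2) * c (n + 2)) = t * (d (n + 1) * c (n + 1)) ↔
        √(U n * L n) * c n + G (n + 1) * c (n + 1) + √(U (n + 1) * L (n + 1)) * c (n + 2) =
          t * c (n + 1)) := by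
      intro n hn
      rw [← mul_right_inj' (hd (n + 1) hn).ne' (c := t * c (n + 1))]
      have e1 := hdown' (n + 1) hn
      have e2 : U n * (d n * c n) = d (n + 1) * (√(U n * L n) * c n) := by
        linear_combination c n * hup n hn
      constructor <;> intro h <;> linarith
    constructor
    · rintro ⟨⟨-, h2, h3⟩, -⟩
      exact ⟨hc, h0.1 h2, fun n hn => (h1 n hn).1 (h3 n hn)⟩
    · rintro ⟨-, h2, h3⟩
      exact ⟨⟨fun n hn => by simp [hc n hn], h0.2 h2, fun n hn => (h1 n hn).2 (h3 n hn)⟩, hc⟩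
  constructor
  · rintro ⟨c, hc0, hc⟩
    refine ⟨_, fun h => hc0 ?_, ((key c).2 hc).1⟩
    funext n
    rcases Nat.lt_or_ge k n with hn | hn
    · exact hc.1 n hn
    · exact (mul_eq_zero.1 (congrFun h n)).resolve_left (hd n hn).ne'
  · rintro ⟨c, hc0, hc⟩
    have hdc : (fun n => d n * (c n / d n)) = c := by
      funext n
      rcases Nat.lt_or_ge k n with hn | hn
      · simp [hc.1 n hn]
      · field_simp [(hd n hn).ne']
    refine ⟨fun n => c n / d n, fun h => hc0 ?_, (key _).1 ⟨by rwa [hdc], fun n hn => ?_⟩⟩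
    · rw [← hdc]
      funext n
      simp [show c n / d n = 0 from congrFun h n]
    · simp [hc.1 n hn]

/-! ### The Lamé equation as a tridiagonal eigenvalue problem -/

/-- The value of `μ` forced by the degree `k`, where `r = ∑ i, ρ i`. -/
def vanVleckLead (r : ℝ) (k : ℕ) : ℝ := k * (k - 1) + r * k

theorem vanVleckLead_strictMono {r : ℝ} (hr : 0 < r) : StrictMono (vanVleckLead r) := by
  refine strictMono_nat_of_lt_succ fun n => ?_
  simp only [vanVleckLead]
  push_cast
  have : (0 : ℝ) ≤ n := n.cast_nonneg
  nlinarith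

/-- Put `x = y + α 1` and multiply by `A`, which becomes `y (y + p) (y - q)` with `p = α 1 - α 0`,
`q = α 2 - α 1`. Polynomials agreeing off three points are equal. -/
theorem isLameSolution_comp_iff {α ρ : Fin 3 → ℝ} {μ ν : ℝ} {R : ℝ[X]} :
    IsLameSolution α ρ (C μ * (X - C ν)) (R.comp (X - C (α 1))) ↔
      (X ^ 3 + C ((α 1 - α 0) - (α 2 - α 1)) * X ^ 2 - C ((α 1 - α 0) * (α 2 - α 1)) * X) *
          R.derivative.derivative +
        (C (∑ i, ρ i) * X ^ 2 + C (ρ 1 * ((α 1 - α 0) - (α 2 - α 1)) + ρ 2 * (α 1 - α 0) -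
          ρ 0 * (α 2 - α 1)) * X - C (ρ 1 * ((α 1 - α 0) * (α 2 - α 1)))) * R.derivative =
      C μ * (X - C (ν - α 1)) * R := by
  have key : ∀ y : ℝ, (∀ i, y + α 1 ≠ α i) →
      ((R.comp (X - C (α 1))).derivative.derivative.eval (y + α 1) +
        (∑ i, ρ i / (y + α 1 - α i)) * (R.comp (X - C (α 1))).derivative.eval (y + α 1) =
      (C μ * (X - C ν)).eval (y + α 1) / (∏ i, (y + α 1 - α i)) *
        (R.comp (X - C (α 1))).eval (y + α 1) ↔
      ((X ^ 3 + C ((α 1 - α 0) - (α 2 - α 1)) * X ^ 2 - C ((α 1 - α 0) * (α 2 - α 1)) * X) *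
          R.derivative.derivative +
        (C (∑ i, ρ i) * X ^ 2 + C (ρ 1 * ((α 1 - α 0) - (α 2 - α 1)) + ρ 2 * (α 1 - α 0) -
          ρ 0 * (α 2 - α 1)) * X - C (ρ 1 * ((α 1 - α 0) * (α 2 - α 1)))) * R.derivative).eval y =
      (C μ * (X - C (ν - α 1)) * R).eval y) := by
    intro y hy
    have h0 := sub_ne_zero.2 (hy 0)
    have h1 := sub_ne_zero.2 (hy 1)
    have h2 := sub_ne_zero.2 (hy 2)
    simp only [derivative_comp, derivative_sub, derivative_X, derivative_C, sub_zero,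
      one_mul, eval_comp, eval_sub, eval_add, eval_mul, eval_pow, eval_X, eval_C,
      Fin.sum_univ_three, Fin.prod_univ_three, add_sub_cancel_right] at h1 ⊢
    generalize R.derivative.derivative.eval y = p
    generalize R.derivative.eval y = q
    generalize R.eval y = r
    rw [← mul_right_inj' (mul_ne_zero (mul_ne_zero h0 h1) h2)]
    have e1 : ((y + α 1 - α 0) * y * (y + α 1 - α 2)) * (p + (ρ 0 / (y + α 1 - α 0) + ρ 1 / y +
        ρ 2 / (y + α 1 - α 2)) * q) = (y + α 1 - α 0) * y * (y + α 1 - α 2) * p +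
        (ρ 0 * (y * (y + α 1 - α 2)) + ρ 1 * ((y + α 1 - α 0) * (y + α 1 - α 2)) +
          ρ 2 * ((y + α 1 - α 0) * y)) * q := by
      field_simp
    have e2 : ((y + α 1 - α 0) * y * (y + α 1 - α 2)) * (μ * (y + α 1 - ν) /
        ((y + α 1 - α 0) * y * (y + α 1 - α 2)) * r) = μ * (y + α 1 - ν) * r := by
      field_simp
    rw [e1, e2]
    constructor <;> intro h <;> linear_combination h
  constructor
  · intro h
    refine Polynomial.eq_of_infinite_eval_eq _ _ (Set.Infinite.mono (fun y hy => ?_)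
      (Set.finite_range fun i => α i - α 1).infinite_compl)
    have hy' : ∀ i, y + α 1 ≠ α i := fun i hi => hy ⟨i, by simp [← hi]⟩
    exact (key y hy').1 (h _ hy')
  · intro h x hx
    have := key (x - α 1) (by simpa using hx)
    rw [h, sub_add_cancel] at this
    exact this.2 rfl

/-- Compares coefficients of `X ^ 0` and `X ^ (n + 1)`, keeping only `μ * t * R` on the right so
that `μ * t` acts as the eigenvalue. -/
theorem lame_coeff_iff {a₂ a₁ b₂ b₁ b₀ μ t : ℝ} {R : ℝ[X]} :
    (X ^ 3 + C a₂ * X ^ 2 - C a₁ * X) * R.derivative.derivative +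
        (C b₂ * X ^ 2 + C b₁ * X - C b₀) * R.derivative = C μ * (X - C t) * R ↔
      b₀ * R.coeff 1 = μ * t * R.coeff 0 ∧
      ∀ n : ℕ, (μ - vanVleckLead b₂ n) * R.coeff n +
        -(a₂ * ((n + 1) * n) + b₁ * (n + 1)) * R.coeff (n + 1) +
        (a₁ * ((n + 2) * (n + 1)) + b₀ * (n + 2)) * R.coeff (n + 2) =
          μ * t * R.coeff (n + 1) := by
  have h3 : ∀ n : ℕ, (X ^ 3 * R.derivative.derivative).coeff (n + 1) =
      n * (n - 1) * R.coeff n := by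
    intro n
    rcases n with _ | _ | n
    · simp [coeff_X_pow_mul']
    · simp [coeff_X_pow_mul']
    · rw [show n + 1 + 1 + 1 = n + 3 by ring, coeff_X_pow_mul]
      simp only [coeff_derivative]
      push_cast
      ring
  have h2 : ∀ n : ℕ, (X ^ 2 * R.derivative.derivative).coeff (n + 1) =
      (n + 1) * n * R.coeff (n + 1) := by
    intro n
    rcases n with _ | n
    · simp [coeff_X_pow_mul']
    · rw [show n + 1 + 1 = n + 2 by ring, coeff_X_pow_mul]
      simp only [coeff_derivative]
      push_cast
      ring
  have h2' : ∀ n : ℕ, (X ^ 2 * R.derivative).coeff (n + 1) = n * R.coeff n := by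
    intro n
    rcases n with _ | n
    · simp [coeff_X_pow_mul']
    · rw [show n + 1 + 1 = n + 2 by ring, coeff_X_pow_mul]
      simp only [coeff_derivative]
      push_cast
      ring
  rw [show (X ^ 3 + C a₂ * X ^ 2 - C a₁ * X) * R.derivative.derivative +
        (C b₂ * X ^ 2 + C b₁ * X - C b₀) * R.derivative =
      X ^ 3 * R.derivative.derivative + C a₂ * (X ^ 2 * R.derivative.derivative) -
        C a₁ * (X * R.derivative.derivative) + C b₂ * (X ^ 2 * R.derivative) +
        C b₁ * (X * R.derivative) - C b₀ * R.derivative by ring,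
    show C μ * (X - C t) * R = C μ * (X * R) - C (μ * t) * R by rw [C_mul]; ring,
    Polynomial.ext_iff]
  have hzero : (∀ p : ℝ[X], (X ^ 3 * p).coeff 0 = 0) ∧ (∀ p : ℝ[X], (X ^ 2 * p).coeff 0 = 0) := by
    simp
  constructor
  · intro h
    refine ⟨?_, fun n => ?_⟩
    · have := h 0
      simp only [coeff_add, coeff_sub, coeff_C_mul, hzero.1, hzero.2, coeff_X_mul_zero,
        coeff_derivative] at this
      push_cast at this
      linarith
    · have := h (n + 1)
      simp only [coeff_add, coeff_sub, coeff_C_mul, h3, h2, h2', coeff_X_mul,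
        coeff_derivative] at this
      push_cast at this
      simp only [vanVleckLead]
      linear_combination -this
  · rintro ⟨h0, h1⟩ n
    rcases n with _ | n
    · simp only [coeff_add, coeff_sub, coeff_C_mul, hzero.1, hzero.2, coeff_X_mul_zero,
        coeff_derivative]
      push_cast
      linarith
    · have := h1 n
      simp only [coeff_add, coeff_sub, coeff_C_mul, h3, h2, h2', coeff_X_mul,
        coeff_derivative]
      push_cast
      simp only [vanVleckLead] at this
      linear_combination -this

/-- Coefficients of the tridiagonal matrix of the Lamé operator in the basis `(x - α 1) ^ n`:
lower diagonal. -/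
def lameU (ρ : Fin 3 → ℝ) (k n : ℕ) : ℝ :=
  vanVleckLead (∑ i, ρ i) k - vanVleckLead (∑ i, ρ i) n

/-- The diagonal. -/
def lameG (α ρ : Fin 3 → ℝ) (n : ℕ) : ℝ :=
  -(((α 1 - α 0) - (α 2 - α 1)) * (n * (n - 1)) +
    (ρ 1 * ((α 1 - α 0) - (α 2 - α 1)) + ρ 2 * (α 1 - α 0) - ρ 0 * (α 2 - α 1)) * n)

/-- The upper diagonal. -/
def lameL (α ρ : Fin 3 → ℝ) (n : ℕ) : ℝ :=
  (α 1 - α 0) * (α 2 - α 1) * ((n + 1) * n) + ρ 1 * ((α 1 - α 0) * (α 2 - α 1)) * (n + 1)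

theorem isLameSolution_iff_coeff {α ρ : Fin 3 → ℝ} {μ ν : ℝ} {R : ℝ[X]} :
    IsLameSolution α ρ (C μ * (X - C ν)) (R.comp (X - C (α 1))) ↔
      lameG α ρ 0 * R.coeff 0 + lameL α ρ 0 * R.coeff 1 = μ * (ν - α 1) * R.coeff 0 ∧
      ∀ n : ℕ, (μ - vanVleckLead (∑ i, ρ i) n) * R.coeff n + lameG α ρ (n + 1) * R.coeff (n + 1) +
        lameL α ρ (n + 1) * R.coeff (n + 2) = μ * (ν - α 1) * R.coeff (n + 1) := by
  rw [isLameSolution_comp_iff, lame_coeff_iff]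
  have hG : ∀ n : ℕ, lameG α ρ (n + 1) = -(((α 1 - α 0) - (α 2 - α 1)) * ((n + 1) * n) +
      (ρ 1 * ((α 1 - α 0) - (α 2 - α 1)) + ρ 2 * (α 1 - α 0) - ρ 0 * (α 2 - α 1)) * (n + 1)) := by
    intro n
    simp only [lameG]
    push_cast
    ring
  have hL : ∀ n : ℕ, lameL α ρ (n + 1) = (α 1 - α 0) * (α 2 - α 1) * ((n + 2) * (n + 1)) +
      ρ 1 * ((α 1 - α 0) * (α 2 - α 1)) * (n + 2) := by
    intro n
    simp only [lameL]
    push_cast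
    ring
  simp only [hG, hL]
  simp [lameG, lameL]

theorem sum_rho_pos {ρ : Fin 3 → ℝ} (hρ : ∀ i, 0 < ρ i) : 0 < ∑ i, ρ i :=
  Finset.sum_pos (fun i _ => hρ i) Finset.univ_nonempty

theorem vanVleckLead_pos {ρ : Fin 3 → ℝ} (hρ : ∀ i, 0 < ρ i) {k : ℕ} (hk : 1 ≤ k) :
    0 < vanVleckLead (∑ i, ρ i) k := by
  have := vanVleckLead_strictMono (sum_rho_pos hρ) (show 0 < k by omega)
  simpa [vanVleckLead] using this

/-- The leading coefficient forces `μ`. -/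
theorem IsLameSolution.eq_vanVleckLead {α ρ : Fin 3 → ℝ} {μ ν : ℝ} {R : ℝ[X]}
    (h : IsLameSolution α ρ (C μ * (X - C ν)) (R.comp (X - C (α 1)))) (hR : R ≠ 0) :
    μ = vanVleckLead (∑ i, ρ i) R.natDegree := by
  have := (isLameSolution_iff_coeff.1 h).2 R.natDegree
  rw [coeff_eq_zero_of_natDegree_lt (show R.natDegree < R.natDegree + 1 by omega),
    coeff_eq_zero_of_natDegree_lt (show R.natDegree < R.natDegree + 2 by omega)] at this
  simp only [mul_zero, add_zero, mul_eq_zero] at this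
  exact sub_eq_zero.1 (this.resolve_right (leadingCoeff_ne_zero.2 hR))

theorem IsStieltjesPoly.ne_zero {α ρ : Fin 3 → ℝ} {k : ℕ} {ν : ℝ} {S : ℝ[X]}
    (h : IsStieltjesPoly α ρ k ν S) : S ≠ 0 := by
  rintro rfl
  simpa using h.1

theorem IsStieltjesPoly.natDegree_eq {α ρ : Fin 3 → ℝ} {k : ℕ} {ν : ℝ} {S : ℝ[X]}
    (h : IsStieltjesPoly α ρ k ν S) : S.natDegree = k :=
  natDegree_eq_of_degree_eq_some h.1

theorem Polynomial.comp_X_add_C_comp_X_sub_C (S : ℝ[X]) (a : ℝ) :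
    (S.comp (X + C a)).comp (X - C a) = S := by
  rw [comp_assoc]
  simp

/-- Removes the existential `μ`: Sturm comparison needs the same positive `μ` for both polynomials.
-/
theorem IsStieltjesPoly.isLameSolution {α ρ : Fin 3 → ℝ} {k : ℕ} {ν : ℝ} {S : ℝ[X]}
    (h : IsStieltjesPoly α ρ k ν S) :
    IsLameSolution α ρ (C (vanVleckLead (∑ i, ρ i) k) * (X - C ν)) S := by
  obtain ⟨μ, hμ⟩ := h.2
  rw [← Polynomial.comp_X_add_C_comp_X_sub_C S (α 1)] at hμ
  have hd : (S.comp (X + C (α 1))).natDegree = k := by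
    rw [natDegree_comp, h.natDegree_eq, natDegree_X_add_C, mul_one]
  have h0 : S.comp (X + C (α 1)) ≠ 0 := fun h1 => h.ne_zero (by
    rw [← Polynomial.comp_X_add_C_comp_X_sub_C S (α 1), h1, zero_comp])
  have hμ' := hμ.eq_vanVleckLead h0
  rw [hd] at hμ'
  rwa [← hμ', ← Polynomial.comp_X_add_C_comp_X_sub_C S (α 1)]

theorem IsStieltjesPoly.exists_jacobiEigen {α ρ : Fin 3 → ℝ} {k : ℕ} {ν : ℝ} {S : ℝ[X]}
    (h : IsStieltjesPoly α ρ k ν S) :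
    ∃ c, c ≠ 0 ∧ JacobiEigen (lameU ρ k) (lameG α ρ) (lameL α ρ) k
      (vanVleckLead (∑ i, ρ i) k * (ν - α 1)) c := by
  have hS := h.isLameSolution
  rw [← Polynomial.comp_X_add_C_comp_X_sub_C S (α 1)] at hS
  have hd : (S.comp (X + C (α 1))).natDegree = k := by
    rw [natDegree_comp, h.natDegree_eq, natDegree_X_add_C, mul_one]
  have h0 : S.comp (X + C (α 1)) ≠ 0 := fun h1 => h.ne_zero (by
    rw [← Polynomial.comp_X_add_C_comp_X_sub_C S (α 1), h1, zero_comp])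
  obtain ⟨h1, h2⟩ := isLameSolution_iff_coeff.1 hS
  refine ⟨(S.comp (X + C (α 1))).coeff, fun hc => h0 (Polynomial.ext fun n => congrFun hc n),
    fun n hn => coeff_eq_zero_of_natDegree_lt (by omega), h1, fun n _ => h2 n⟩

theorem exists_isStieltjesPoly {α ρ : Fin 3 → ℝ} (hρ : ∀ i, 0 < ρ i) {k : ℕ} {ν : ℝ}
    {c : ℕ → ℝ} (hc0 : c ≠ 0)
    (hc : JacobiEigen (lameU ρ k) (lameG α ρ) (lameL α ρ) k
      (vanVleckLead (∑ i, ρ i) k * (ν - α 1)) c) :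
    ∃ S, IsStieltjesPoly α ρ k ν S := by
  obtain ⟨h1, h2, h3⟩ := hc
  set R : ℝ[X] := ∑ n ∈ Finset.range (k + 1), monomial n (c n) with hR
  have hcoeff : ∀ n, R.coeff n = c n := by
    intro n
    simp only [hR, finsetSum_coeff, coeff_monomial, Finset.sum_ite_eq', Finset.mem_range]
    split_ifs with h
    · rfl
    · exact (h1 n (by omega)).symm
  have hR0 : R ≠ 0 := fun h => hc0 (funext fun n => by rw [← hcoeff, h]; simp)
  have hsol : IsLameSolution α ρ (C (vanVleckLead (∑ i, ρ i) k) * (X - C ν))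
      (R.comp (X - C (α 1))) := by
    rw [isLameSolution_iff_coeff]
    simp only [hcoeff]
    refine ⟨h2, fun n => ?_⟩
    -- The recurrence closes up at `n = k`: there `μ - vanVleckLead _ k = 0` and the higher
    -- coefficients vanish.
    rcases lt_trichotomy n k with hn | rfl | hn
    · exact h3 n hn
    · simp [h1 (n + 1) (by omega), h1 (n + 2) (by omega)]
    · simp [h1 n hn, h1 (n + 1) (by omega), h1 (n + 2) (by omega)]
  -- The entry `c k` is not assumed nonzero; the degree is recovered from `μ` by injectivity of
  -- `vanVleckLead`.
  have hdeg : R.natDegree = k :=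
    ((vanVleckLead_strictMono (sum_rho_pos hρ)).injective (hsol.eq_vanVleckLead hR0)).symm
  have hd : (R.comp (X - C (α 1))).natDegree = k := by
    rw [natDegree_comp, hdeg, natDegree_X_sub_C, mul_one]
  refine ⟨R.comp (X - C (α 1)), ?_, _, hsol⟩
  rw [degree_eq_natDegree, hd]
  intro h
  apply hR0
  have := congrArg (fun p => p.comp (X + C (α 1))) h
  simpa [comp_assoc] using this

theorem exists_vanVleckZeros {α ρ : Fin 3 → ℝ} (hα : StrictMono α) (hρ : ∀ i, 0 < ρ i)
    {k : ℕ} (hk : 1 ≤ k) :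
    ∃ ν : Fin (k + 1) → ℝ, StrictMono ν ∧ Set.range ν = vanVleckZeros α ρ k := by
  have hmono := vanVleckLead_strictMono (sum_rho_pos hρ)
  have hμ := vanVleckLead_pos hρ hk
  have h01 : 0 < α 1 - α 0 := sub_pos.2 (hα (by decide))
  have h12 : 0 < α 2 - α 1 := sub_pos.2 (hα (by decide))
  obtain ⟨l, hl, hl'⟩ := exists_jacobiEigen (lameU ρ k) (lameG α ρ) (lameL α ρ) k
    (fun n hn => sub_pos.2 (hmono hn)) (fun n _ => by
      have := hρ 1
      simp only [lameL]
      positivity)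
  refine ⟨fun i => α 1 + l i / vanVleckLead (∑ i, ρ i) k, fun i j hij => ?_, ?_⟩
  · have := div_lt_div_of_pos_right (hl hij) hμ
    simpa using this
  · ext ν
    constructor
    · rintro ⟨i, rfl⟩
      obtain ⟨c, hc0, hc⟩ := (hl' (l i)).1 ⟨i, rfl⟩
      refine exists_isStieltjesPoly hρ hc0 ?_
      rwa [add_sub_cancel_left, mul_div_cancel₀ _ hμ.ne']
    · rintro ⟨S, hS⟩
      obtain ⟨i, hi⟩ := (hl' _).2 hS.exists_jacobiEigen
      refine ⟨i, ?_⟩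
      simp only [hi]
      field_simp
      ring

/-! ### Zero counts on the two intervals -/

/-- Zeros of the Stieltjes polynomials of two Van Vleck zeros between the first two singular
points. -/
theorem IsStieltjesPoly.exists_interlacing_left {α ρ : Fin 3 → ℝ} (hα : StrictMono α)
    (hρ : ∀ i, 0 < ρ i) {k : ℕ} (hk : 1 ≤ k) {ν ν' : ℝ} {S T : ℝ[X]}
    (hS : IsStieltjesPoly α ρ k ν S) (hT : IsStieltjesPoly α ρ k ν' T) (hν : ν < ν') :
    ∃ e z : ℕ → ℝ,
      (∀ i < (rootsIoo S (α 0) (α 1)).card, S.IsRoot (e i) ∧ α 0 < e i ∧ e i < α 1) ∧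
      (∀ i ≤ (rootsIoo S (α 0) (α 1)).card, T.IsRoot (z i) ∧ α 0 < z i ∧ z i < α 1) ∧
      ∀ i < (rootsIoo S (α 0) (α 1)).card, z i < e i ∧ e i < z (i + 1) := by
  have h01 : α 0 < α 1 := hα (by decide)
  have h12 : α 1 < α 2 := hα (by decide)
  refine exists_interlacing hS.ne_zero h01 fun c d hac hcd hdb hc hd hS0 => ?_
  have hx : ∀ x ∈ Set.Ioo c d, 0 < x - α 0 ∧ x - α 1 < 0 ∧ x - α 2 < 0 := fun x hx =>
    ⟨by linarith [hx.1], by linarith [hx.2], by linarith [hx.2]⟩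
  refine hS.isLameSolution.exists_isRoot_of_lt hρ hT.isLameSolution hcd (fun x hxm => ?_)
    (fun x hxm => ?_) (hc.imp_left fun h => ⟨0, h⟩) (hd.imp_left fun h => ⟨1, h⟩) hS0
  · obtain ⟨h0, h1, h2⟩ := hx x hxm
    rw [Fin.forall_fin_succ, Fin.forall_fin_two]
    exact ⟨sub_ne_zero.1 h0.ne', sub_ne_zero.1 h1.ne, sub_ne_zero.1 h2.ne⟩
  · obtain ⟨h0, h1, h2⟩ := hx x hxm
    rw [Fin.prod_univ_three]
    refine div_lt_div_of_pos_right ?_ (mul_pos_of_neg_of_neg (mul_neg_of_pos_of_neg h0 h1) h2)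
    simp only [eval_mul, eval_C, eval_sub, eval_X]
    exact mul_lt_mul_of_pos_left (by linarith) (vanVleckLead_pos hρ hk)

/-- Zeros of the Stieltjes polynomials of two Van Vleck zeros between the last two singular
points. -/
theorem IsStieltjesPoly.exists_interlacing_right {α ρ : Fin 3 → ℝ} (hα : StrictMono α)
    (hρ : ∀ i, 0 < ρ i) {k : ℕ} (hk : 1 ≤ k) {ν ν' : ℝ} {S T : ℝ[X]}
    (hS : IsStieltjesPoly α ρ k ν S) (hT : IsStieltjesPoly α ρ k ν' T) (hν : ν' < ν) :
    ∃ e z : ℕ → ℝ,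
      (∀ i < (rootsIoo S (α 1) (α 2)).card, S.IsRoot (e i) ∧ α 1 < e i ∧ e i < α 2) ∧
      (∀ i ≤ (rootsIoo S (α 1) (α 2)).card, T.IsRoot (z i) ∧ α 1 < z i ∧ z i < α 2) ∧
      ∀ i < (rootsIoo S (α 1) (α 2)).card, z i < e i ∧ e i < z (i + 1) := by
  have h01 : α 0 < α 1 := hα (by decide)
  have h12 : α 1 < α 2 := hα (by decide)
  refine exists_interlacing hS.ne_zero h12 fun c d hac hcd hdb hc hd hS0 => ?_
  have hx : ∀ x ∈ Set.Ioo c d, 0 < x - α 0 ∧ 0 < x - α 1 ∧ x - α 2 < 0 := fun x hx =>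
    ⟨by linarith [hx.1], by linarith [hx.1], by linarith [hx.2]⟩
  refine hS.isLameSolution.exists_isRoot_of_lt hρ hT.isLameSolution hcd (fun x hxm => ?_)
    (fun x hxm => ?_) (hc.imp_left fun h => ⟨1, h⟩) (hd.imp_left fun h => ⟨2, h⟩) hS0
  · obtain ⟨h0, h1, h2⟩ := hx x hxm
    rw [Fin.forall_fin_succ, Fin.forall_fin_two]
    exact ⟨sub_ne_zero.1 h0.ne', sub_ne_zero.1 h1.ne', sub_ne_zero.1 h2.ne⟩
  · obtain ⟨h0, h1, h2⟩ := hx x hxm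
    rw [Fin.prod_univ_three]
    -- Here `A < 0`, which is why the order of `ν` and `ν'` is opposite to that on the left
    -- interval.
    refine div_lt_div_of_neg_of_lt (mul_neg_of_pos_of_neg (mul_pos h0 h1) h2) ?_
    simp only [eval_mul, eval_C, eval_sub, eval_X]
    exact mul_lt_mul_of_pos_left (by linarith) (vanVleckLead_pos hρ hk)

theorem card_lt_card_rootsIoo {T : ℝ[X]} (hT : T ≠ 0) {a b : ℝ} {m : ℕ} {e z : ℕ → ℝ}
    (hz : ∀ i ≤ m, T.IsRoot (z i) ∧ a < z i ∧ z i < b)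
    (hez : ∀ i < m, z i < e i ∧ e i < z (i + 1)) : m < (rootsIoo T a b).card := by
  have hmono : StrictMono fun i : Fin (m + 1) => z i :=
    Fin.strictMono_iff_lt_succ.2 fun i => ((hez i i.isLt).1.trans (hez i i.isLt).2)
  have := Finset.card_le_card_of_injOn (s := (Finset.univ : Finset (Fin (m + 1))))
    (t := rootsIoo T a b) (fun i => z i)
    (fun i _ => (mem_rootsIoo hT).2 (hz i (Nat.lt_succ_iff.1 i.isLt))) hmono.injective.injOn
  simpa using this

theorem card_rootsIoo_add_le {S : ℝ[X]} {k : ℕ} (hk : S.natDegree = k) (a b c : ℝ) :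
    (rootsIoo S a b).card + (rootsIoo S b c).card ≤ k := by
  rw [← Finset.card_union_of_disjoint]
  · refine (Finset.card_le_card (Finset.union_subset (Finset.filter_subset _ _)
      (Finset.filter_subset _ _))).trans ?_
    rw [← hk]
    exact (Multiset.toFinset_card_le _).trans S.card_roots'
  · refine Finset.disjoint_filter.2 fun x _ h1 h2 => ?_
    linarith [h1.2, h2.1]

theorem range_eq_setOf_isRoot {S : ℝ[X]} (hS : S ≠ 0) {k : ℕ} (hk : S.natDegree = k)
    {x : Fin k → ℝ} (hx : StrictMono x) (hr : ∀ i, S.IsRoot (x i)) :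
    Set.range x = {t | S.IsRoot t} := by
  have hsub : Finset.univ.image x ⊆ S.roots.toFinset := by
    intro t ht
    obtain ⟨i, -, rfl⟩ := Finset.mem_image.1 ht
    simpa [hS] using hr i
  have heq := Finset.eq_of_subset_of_card_le hsub (by
    rw [Finset.card_image_of_injective _ hx.injective, Finset.card_fin, ← hk]
    exact (Multiset.toFinset_card_le _).trans S.card_roots')
  ext t
  have := Finset.ext_iff.1 heq t
  simpa [hS] using this

section Count

variable {α ρ : Fin 3 → ℝ} {k : ℕ} {ν : Fin (k + 1) → ℝ}

/-- Induction on the index: passing to the next Van Vleck zero gains a zero, since `m` zeros cut the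
interval into `m + 1` gaps. -/
theorem le_card_rootsIoo_left (hα : StrictMono α) (hρ : ∀ i, 0 < ρ i) (hk : 1 ≤ k)
    (hν : StrictMono ν) (hr : Set.range ν = vanVleckZeros α ρ k) :
    ∀ (n : ℕ) (hn : n < k + 1) (S : ℝ[X]), IsStieltjesPoly α ρ k (ν ⟨n, hn⟩) S →
      n ≤ (rootsIoo S (α 0) (α 1)).card := by
  intro n
  induction n with
  | zero => simp
  | succ n ih =>
    intro hn T hT
    obtain ⟨S, hS⟩ : ν ⟨n, by omega⟩ ∈ vanVleckZeros α ρ k := hr ▸ Set.mem_range_self _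
    obtain ⟨e, z, -, hz, hez⟩ := hS.exists_interlacing_left hα hρ hk hT (hν (by simp))
    exact (ih _ S hS).trans_lt (card_lt_card_rootsIoo hT.ne_zero hz hez)

/-- Induction downwards from the largest Van Vleck zero, `m` being the distance to it. -/
theorem le_card_rootsIoo_right (hα : StrictMono α) (hρ : ∀ i, 0 < ρ i) (hk : 1 ≤ k)
    (hν : StrictMono ν) (hr : Set.range ν = vanVleckZeros α ρ k) :
    ∀ (n m : ℕ) (hn : n < k + 1) (S : ℝ[X]), n + m = k → IsStieltjesPoly α ρ k (ν ⟨n, hn⟩) S →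
      m ≤ (rootsIoo S (α 1) (α 2)).card := by
  intro n m
  induction m generalizing n with
  | zero => simp
  | succ m ih =>
    intro hn T hnm hT
    obtain ⟨S, hS⟩ : ν ⟨n + 1, by omega⟩ ∈ vanVleckZeros α ρ k := hr ▸ Set.mem_range_self _
    obtain ⟨e, z, -, hz, hez⟩ := hS.exists_interlacing_right hα hρ hk hT (hν (by simp))
    exact (ih _ _ S (by omega) hS).trans_lt (card_lt_card_rootsIoo hT.ne_zero hz hez)

theorem card_rootsIoo_eq (hα : StrictMono α) (hρ : ∀ i, 0 < ρ i) (hk : 1 ≤ k)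
    (hν : StrictMono ν) (hr : Set.range ν = vanVleckZeros α ρ k) (j : Fin (k + 1)) {S : ℝ[X]}
    (hS : IsStieltjesPoly α ρ k (ν j) S) :
    (rootsIoo S (α 0) (α 1)).card = j ∧ (rootsIoo S (α 1) (α 2)).card = k - j := by
  have h1 := le_card_rootsIoo_left hα hρ hk hν hr j j.isLt S hS
  have h2 := le_card_rootsIoo_right hα hρ hk hν hr j (k - j) j.isLt S (by omega) hS
  have h3 := card_rootsIoo_add_le hS.natDegree_eq (α 0) (α 1) (α 2)
  omega

end Count

/-! ### Joining the interlacings across the middle singular point -/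

theorem Fin.strictMono_of_interlacing {k : ℕ} {x y : ℕ → ℝ} (h1 : ∀ i < k, y i < x i)
    (h2 : ∀ i, i + 1 < k → x i < y (i + 1)) :
    (StrictMono fun i : Fin k => x i) ∧ StrictMono fun i : Fin k => y i := by
  cases k with
  | zero => exact ⟨fun i => i.elim0, fun i => i.elim0⟩
  | succ k =>
    refine ⟨Fin.strictMono_iff_lt_succ.2 fun i => ?_, Fin.strictMono_iff_lt_succ.2 fun i => ?_⟩
    · exact (h2 i (by simp)).trans (h1 (i + 1) (by simp))
    · exact (h1 i (by omega)).trans (h2 i (by simp))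

theorem exists_interlacing_of_consecutive {α ρ : Fin 3 → ℝ} {k : ℕ} {ν : Fin (k + 1) → ℝ}
    (hα : StrictMono α) (hρ : ∀ i, 0 < ρ i) (hk : 1 ≤ k)
    (hν : StrictMono ν) (hr : Set.range ν = vanVleckZeros α ρ k) (j : Fin k) {S T : ℝ[X]}
    (hS : IsStieltjesPoly α ρ k (ν j.castSucc) S) (hT : IsStieltjesPoly α ρ k (ν j.succ) T) :
    ∃ x y : ℕ → ℝ, (∀ i < k, S.IsRoot (x i) ∧ T.IsRoot (y i) ∧ α 0 < y i ∧ y i < x i ∧ x i < α 2) ∧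
      ∀ i, i + 1 < k → x i < y (i + 1) := by
  have hjj : ν j.castSucc < ν j.succ := hν (by simp [Fin.lt_def])
  have h01 : α 0 < α 1 := hα (by decide)
  have h12 : α 1 < α 2 := hα (by decide)
  obtain ⟨e, z, he, hz, hez⟩ := hS.exists_interlacing_left hα hρ hk hT hjj
  obtain ⟨e', z', he', hz', hez'⟩ := hT.exists_interlacing_right hα hρ hk hS hjj
  rw [(card_rootsIoo_eq hα hρ hk hν hr _ hS).1] at he hz hez
  rw [(card_rootsIoo_eq hα hρ hk hν hr _ hT).2] at he' hz' hez'
  simp only [Fin.val_castSucc, Fin.val_succ] at he hz hez he' hz' hez'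
  have hj := j.isLt
  -- On the left `S` has `j` zeros `e` and `T` has `j + 1` zeros `z`; on the right `T` has `k - j -
  -- 1` zeros `e'` and `S` has `k - j` zeros `z'`. At `i = j` the point `α 1` separates `y i` from
  -- `x i`.
  refine ⟨fun i => if i < (j : ℕ) then e i else z' (i - j),
    fun i => if i ≤ (j : ℕ) then z i else e' (i - j - 1), fun i hi => ?_, fun i hi => ?_⟩
  · rcases lt_trichotomy i (j : ℕ) with h | h | h
    · simp only [h, h.le, if_true]
      exact ⟨(he i h).1, (hz i h.le).1, (hz i h.le).2.1, (hez i h).1, (he i h).2.2.trans h12⟩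
    · simp only [h, lt_irrefl, le_refl, if_true, if_false, Nat.sub_self]
      have a1 := hz' 0 (by omega)
      have a2 := hz j le_rfl
      exact ⟨a1.1, a2.1, a2.2.1, a2.2.2.trans a1.2.1, a1.2.2⟩
    · simp only [not_lt.2 h.le, not_le.2 h, if_false]
      have a1 := hz' (i - j) (by omega)
      have a2 := he' (i - j - 1) (by omega)
      have a3 := (hez' (i - j - 1) (by omega)).2
      rw [show i - (j : ℕ) - 1 + 1 = i - j by omega] at a3
      exact ⟨a1.1, a2.1, h01.trans a2.2.1, a3, a1.2.2⟩
  · rcases Nat.lt_or_ge i (j : ℕ) with h | h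
    · simp only [h, show i + 1 ≤ (j : ℕ) by omega, if_true]
      exact (hez i h).2
    · simp only [not_lt.2 h, show ¬ i + 1 ≤ (j : ℕ) by omega, if_false]
      rw [show i + 1 - (j : ℕ) - 1 = i - j by omega]
      exact (hez' (i - j) (by omega)).1

theorem theorem2 (α ρ : Fin 3 → ℝ) (hα : StrictMono α) (hρ : ∀ i, 0 < ρ i)
    (k : ℕ) (hk : 1 ≤ k) :
    ∃ ν : Fin (k + 1) → ℝ, StrictMono ν ∧ Set.range ν = vanVleckZeros α ρ k ∧
      ∀ (j : Fin k) (S T : ℝ[X]),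
        IsStieltjesPoly α ρ k (ν j.castSucc) S → IsStieltjesPoly α ρ k (ν j.succ) T →
        ∃ x y : Fin k → ℝ,
          StrictMono x ∧ Set.range x = {t | S.IsRoot t} ∧
          StrictMono y ∧ Set.range y = {t | T.IsRoot t} ∧
          (∀ i, α 0 < y i ∧ y i < x i ∧ x i < α 2) ∧
          (∀ i i' : Fin k, (i : ℕ) + 1 = (i' : ℕ) →
            x i < y i' ∧ ∃! t : ℝ, T.IsRoot t ∧ x i < t ∧ t < x i') := by
  obtain ⟨ν, hν, hr⟩ := exists_vanVleckZeros hα hρ hk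
  refine ⟨ν, hν, hr, fun j S T hS hT => ?_⟩
  obtain ⟨x, y, h1, h2⟩ := exists_interlacing_of_consecutive hα hρ hk hν hr j hS hT
  obtain ⟨hx, hy⟩ := Fin.strictMono_of_interlacing (fun i hi => (h1 i hi).2.2.2.1) h2
  have hyr := range_eq_setOf_isRoot hT.ne_zero hT.natDegree_eq hy fun i => (h1 i i.isLt).2.1
  refine ⟨fun i => x i, fun i => y i, hx,
    range_eq_setOf_isRoot hS.ne_zero hS.natDegree_eq hx fun i => (h1 i i.isLt).1, hy, hyr,
    fun i => (h1 i i.isLt).2.2, fun i i' hii => ?_⟩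
  have hlt : x i < y i' := by
    rw [← hii]
    exact h2 i (by omega)
  refine ⟨hlt, y i', ⟨(h1 i' i'.isLt).2.1, hlt, (h1 i' i'.isLt).2.2.2.1⟩, ?_⟩
  rintro t ⟨ht, hxt, htx⟩
  -- Every zero of `T` is some `y l`; interlacing forces `i < l ≤ i'`, and `i' = i + 1`.
  obtain ⟨l, rfl⟩ : t ∈ Set.range fun i : Fin k => y i := hyr ▸ ht
  have hl1 : (i : ℕ) < l := by
    by_contra! h
    have := hy.monotone (show l ≤ i from h)
    have := (h1 i i.isLt).2.2.2.1
    simp only at *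
    linarith
  have hl2 : (l : ℕ) ≤ i' := by
    by_contra! h
    have hm : y (i' + 1) ≤ y l :=
      hy.monotone (a := ⟨i' + 1, by omega⟩) (b := l) (Fin.le_def.2 h)
    have := h2 i' (by omega)
    simp only at *
    linarith
  exact congrArg y (show (l : ℕ) = i' by omega)
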